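/- Fix an arbitrary acceptable programming system $\varphi$, i.e. a numbering $(\varphi_p)_{p\in\mathbb N}$ such that $(p,x)\mapsto\varphi_p(x)$ is partial computable and for every partial computable $(p,x)\mapsto\psi_p(x)$ there is a total computable $f$ with $\varphi_{f(p)}=\psi_p$ for all $p$. Let $W_p=\operatorname{dom}(\varphi_p)$. A language is a computably enumerable set $L\subseteq\mathbb N$. A text for $L$ is a sequence $T\colon\mathbb N\to\mathbb N\cup\{\#\}$ with $\operatorname{ran}(T)\setminus\{\#\}=L$; $T[t]$ denotes the sequence of its first $t$ entries. A bounded memory states (BMS) learner is given by partial computable functions $h_M\colon\mathbb N\times(\mathbb N\cup\{\#\})\to\mathbb N\cup\{?\}$ and $s_M\colon\mathbb N\times(\mathbb N\cup\{\#\})\to\mathbb N$ with the same domain. Its states are $s_M^*(\epsilon)=0$ and $s_M^*(\sigma x)=s_M(s_M^*(\sigma),x)$, and its conjectures are $M(\epsilon)=\,?$ and $M(\sigma x)=h_M(s_M^*(\sigma),x)$. Its learning sequence on a text $T$ is $h_t=M(T[t])$, $t\in\mathbb N$. The symbol $?$ means "no hypothesis, or repetition of the previous one". Let $T$ be a text for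 $L$ on which all $h_t$ are defined. We write * $\mathrm{BMS}_*$ if $\{s_M^*(T[t]) : t\in\mathbb N\}$ is finite; * $\mathrm{Ex}$ if there is $t_0$ with $h_{t_0}\neq\,?$, $W_{h_{t_0}}=L$, and $h_t\in\{?,h_{t_0}\}$ for all $t\ge t_0$; * $\mathrm{SMon}$ (strongly monotonic) if $W_{h_s}\subseteq W_{h_t}$ whenever $s\le t$ and $h_s,h_t\neq\,?$; * $\mathrm{SNU}$ (strongly non-U-shaped) if $h_r=h_s$ whenever $r\le s\le t$, $h_r,h_s,h_t\neq\,?$ and $W_{h_r}=W_{h_t}=L$. For $\delta\in\{\mathrm{SMon},\mathrm{SNU}\}$ let $[\mathrm{Txt}\,\mathrm{BMS}_*\,\delta\,\mathrm{Ex}]$ be the set of all classes $\mathcal L$ of languages for which there is one BMS learner such that, for every $L\in\mathcal L$ and every text for $L$, the learning sequence is everywhere defined and satisfies $\mathrm{BMS}_*$, $\delta$ and $\mathrm{Ex}$; let $[\mathrm{Txt}\,\mathrm{BMS}_*\,\mathrm{Ex}]$ be defined in the same way without the condition $\delta$. **Theorem.** $[\mathrm{Txt}\,\mathrm{BMS}_*\,\mathrm{SMon}\,\mathrm{Ex}]\not\subseteq[\mathrm{Txt}\,\mathrm{BMS}_*\,\mathrm{SNU}\,\mathrm{Ex}]$.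 Moreover, $[\mathrm{Txt}\,\mathrm{BMS}_*\,\mathrm{SNU}\,\mathrm{Ex}]\subsetneq[\mathrm{Txt}\,\mathrm{BMS}_*\,\mathrm{Ex}]$. -/

import Mathlib

namespace LimitLearning

/-- `φ p` is the partial function computed by program `p`.  The numbering `φ` is an acceptable
programming system: it has a partial computable universal function, and every uniformly partial
computable family `ψ` translates into it computably. -/
def IsAcceptable (φ : ℕ → ℕ →. ℕ) : Prop :=
  Partrec₂ φ ∧
    ∀ ψ : ℕ → ℕ →. ℕ, Partrec₂ ψ → ∃ f : ℕ → ℕ, Computable f ∧ ∀ p, φ (f p) = ψ p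

/-- `W φ p` is the domain of `φ p`. -/
def W (φ : ℕ → ℕ →. ℕ) (p : ℕ) : Set ℕ := {x | (φ p x).Dom}

/-- The input alphabet `ℕ ∪ {#}`; the pause symbol `#` is `none`. -/
abbrev Datum : Type := Option ℕ

/-- The output alphabet `ℕ ∪ {?}`; the symbol `?` is `none`. -/
abbrev Conjecture : Type := Option ℕ

/-- The content of an infinite sequence over the input alphabet. -/
def content (T : ℕ → Datum) : Set ℕ := {n | ∃ i, T i = some n}

/-- `T` is a text for `L`. -/
def IsTextFor (T : ℕ → Datum) (L : Set ℕ) : Prop := content T = L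

/-- The initial segment `T[t]`, consisting of the first `t` data of `T`. -/
def initSeg (T : ℕ → Datum) (t : ℕ) : List Datum := (List.range t).map T

/-- A bounded memory states learner: a partial computable hypothesis generating function and
a partial computable state transition function with the same domain; states are natural numbers
and the initial state is `0`. -/
structure BMSLearner where
  hyp : ℕ → Datum →. Conjecture
  trans : ℕ → Datum →. ℕ
  hyp_partrec : Partrec₂ hyp
  trans_partrec : Partrec₂ trans
  dom_eq : ∀ q x, (hyp q x).Dom ↔ (trans q x).Dom

/-- The state reached after reading a finite sequence, started in state `0`. -/
def BMSLearner.state (M : BMSLearner) (σ : List Datum) : Part ℕ := σ.foldlM M.trans 0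

/-- The partial function from finite sequences to conjectures given by the learner: on `σ ⌢ x` it is
the conjecture produced from the state after `σ` and the datum `x`; on the empty sequence there
is no hypothesis yet, so it is `?`. -/
def BMSLearner.output (M : BMSLearner) (σ : List Datum) : Part Conjecture :=
  match σ.getLast? with
  | none => Part.some none
  | some x => (M.state σ.dropLast).bind fun q => M.hyp q x

theorem BMSLearner.state_nil (M : BMSLearner) : M.state [] = Part.some 0 := rfl

theorem BMSLearner.state_append (M : BMSLearner) (σ : List Datum) (x : Datum) :
    M.state (σ ++ [x]) = (M.state σ).bind fun q => M.trans q x := by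
  unfold BMSLearner.state
  have h : List.foldlM M.trans 0 (σ ++ [x]) =
      List.foldlM M.trans 0 σ >>= fun q => List.foldlM M.trans q [x] := List.foldlM_append
  rw [h]
  have hx : ∀ q, List.foldlM M.trans q [x] = M.trans q x := fun q => bind_pure (M.trans q x)
  simp only [hx]
  rfl

theorem BMSLearner.output_nil (M : BMSLearner) : M.output [] = Part.some none := rfl

theorem BMSLearner.output_append (M : BMSLearner) (σ : List Datum) (x : Datum) :
    M.output (σ ++ [x]) = (M.state σ).bind fun q => M.hyp q x := by
  simp [BMSLearner.output]

/-- `h` is the learning sequence of `M` on `T`; in particular, `M` is defined on all initial segments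
of `T`. -/
def BMSLearner.IsLearningSeq (M : BMSLearner) (T : ℕ → Datum) (h : ℕ → Conjecture) : Prop :=
  ∀ t, h t ∈ M.output (initSeg T t)

/-- `M` uses only finitely many memory states on `T`. -/
def BMSLearner.FinitelyManyStates (M : BMSLearner) (T : ℕ → Datum) : Prop :=
  {q : ℕ | ∃ t, q ∈ M.state (initSeg T t)}.Finite

/-- Explanatory convergence of the learning sequence `h` to an index of `L`. -/
def Ex (φ : ℕ → ℕ →. ℕ) (h : ℕ → Conjecture) (L : Set ℕ) : Prop :=
  ∃ t₀ e, h t₀ = some e ∧ W φ e = L ∧ ∀ t, t₀ ≤ t → h t ≠ none → h t = h t₀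

/-- A learning restriction: a condition on a learning sequence `h` and the content `L` of the text.
The restrictions below compare hypotheses proper; the symbol `?` stands for no hypothesis or for a
repetition of the previous one, and hence is never a change of hypothesis. -/
abbrev Restriction : Type := (ℕ → Conjecture) → Set ℕ → Prop

/-- No restriction. -/
def NoRestriction : Restriction := fun _ _ => True

/-- Strongly monotonic. -/
def SMon (φ : ℕ → ℕ →. ℕ) : Restriction := fun h _ =>
  ∀ s t, s ≤ t → ∀ d e, h s = some d → h t = some e → W φ d ⊆ W φ e

/-- Strongly non-U-shaped: between two correct hypotheses, the hypothesis does not change. -/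
def SNU (φ : ℕ → ℕ →. ℕ) : Restriction := fun h L =>
  ∀ r s t, r ≤ s → s ≤ t → ∀ c d e, h r = some c → h s = some d → h t = some e →
    W φ c = L → W φ e = L → c = d

/-- The collection of all classes of computably enumerable languages for which a single bounded
memory states learner, on every text for every language of the class, converges explanatorily
(with respect to `φ`), fulfils the restriction `δ`, and uses finitely many states only. -/
def TxtBMSEx (φ : ℕ → ℕ →. ℕ) (δ : Restriction) : Set (Set (Set ℕ)) :=
  {𝓛 | (∀ L ∈ 𝓛, REPred fun n => n ∈ L) ∧
    ∃ M : BMSLearner, ∀ L ∈ 𝓛, ∀ T : ℕ → Datum, IsTextFor T L →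
      ∃ h : ℕ → Conjecture, M.IsLearningSeq T h ∧ M.FinitelyManyStates T ∧ δ h L ∧ Ex φ h L}

end LimitLearning

/-!
The separating class diagonalizes against machines `c` that simulate a learner and remember its last
hypothesis. A learner that has to be correct on the whole chain of `c`, which lasts as long as new
configurations keep appearing, may only use finitely many configurations on it; so some
configuration of `c` recurs infinitely often along the points of its chain. Leave the chain at such
a point `k` by showing a marker, and then pause until `c` loops with a fixed hypothesis. The
languages are arranged so that `stubLang c k` grows into `fullLang c k` exactly if `c` reacts, that
is, if some further points make it change this hypothesis. If `c` does not react, then it has the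
same hypothesis on the finite stub and on the infinite full language. If it does, both languages are
the chain cut at a later occurrence of the same configuration, after a reaction has been found. `c`
cannot tell this longer language from the stub, so its hypothesis is correct on it; yet the
reaction, all of whose points belong to the language, makes `c` abandon this correct hypothesis.

A strongly monotonic learner can pass from the chain to the stub when it sees the marker, and to the
full language when it sees a point beyond `k`. It may change from a correct stub to the equally
correct full language, which is just what strong non-U-shapedness forbids.
-/

namespace LimitLearning

open Encodable
open Nat.Partrec (Code)

section RecursivelyEnumerable

variable {α β : Type*} [Primcodable α] [Primcodable β]

theorem rePred_comp {p : β → Prop} (hp : REPred p) {f : α → β} (hf : Computable f) :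
    REPred fun a => p (f a) :=
  Partrec.comp hp hf

theorem rePred_and {p q : α → Prop} (hp : REPred p) (hq : REPred q) :
    REPred fun a => p a ∧ q a :=
  (Partrec.bind hp (hq.comp Computable.fst).to₂).dom_re.of_eq fun a => by
    simp only [Part.bind_dom, Part.assert, exists_prop]
    exact ⟨fun ⟨⟨hp, _⟩, hq, _⟩ => ⟨hp, hq⟩, fun ⟨hp, hq⟩ => ⟨⟨hp, trivial⟩, hq, trivial⟩⟩

theorem rePred_or {p q : α → Prop} (hp : REPred p) (hq : REPred q) :
    REPred fun a => p a ∨ q a := by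
  obtain ⟨k, hk, hmem⟩ := Partrec.merge' hp hq
  refine hk.dom_re.of_eq fun a => ?_
  simp only [(hmem a).2, Part.assert, exists_prop, Part.some_dom, and_true]

theorem rePred_exists_of_primrecRel {R : α → ℕ → Prop} (hR : PrimrecRel R) :
    REPred fun a => ∃ u, R a u := by
  classical
  have hsearch : Partrec fun a => Nat.rfind fun u => Part.some (decide (R a u)) :=
    Partrec.rfind hR.decide.to_comp.partrec₂
  refine hsearch.dom_re.of_eq fun a => Nat.rfind_dom.trans ?_
  simp

theorem rePred_exists {p : α × β → Prop} (hp : REPred p) : REPred fun a => ∃ b, p (a, b) := by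
  obtain ⟨c, hc⟩ := Code.exists_code.1 hp
  have hdom (n : ℕ) : (c.eval n).Dom ↔ ∃ x, decode n = some x ∧ p x := by
    cases h : (decode n : Option (α × β)) <;> simp [hc, h, Part.assert]
  have hR : PrimrecRel fun (a : α) (u : ℕ) =>
      (Code.evaln u.unpair.1 c (Nat.pair (encode a) u.unpair.2)).isSome = true := by
    have hunpair := Primrec.unpair.comp (Primrec.snd (α := α) (β := ℕ))
    exact Primrec.eq.comp (Primrec.option_isSome.comp (Code.primrec_evaln.comp
      (((Primrec.fst.comp hunpair).pair (Primrec.const c)).pair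
      (Primrec₂.natPair.comp (Primrec.encode.comp Primrec.fst) (Primrec.snd.comp hunpair)))))
      (Primrec.const true)
  refine (rePred_exists_of_primrecRel hR).of_eq fun a => ?_
  calc (∃ u : ℕ, (Code.evaln u.unpair.1 c (Nat.pair (encode a) u.unpair.2)).isSome = true)
      ↔ ∃ n, (c.eval (Nat.pair (encode a) n)).Dom := by
        simp only [Part.dom_iff_mem, Code.evaln_complete, Option.isSome_iff_exists]
        exact ⟨fun ⟨u, z, hz⟩ => ⟨_, z, _, hz⟩,
          fun ⟨n, z, k, hz⟩ => ⟨Nat.pair k n, z, by simpa using hz⟩⟩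
    _ ↔ ∃ b, p (a, b) := by
        simp only [hdom]
        constructor
        · rintro ⟨n, ⟨a', b⟩, hn, hp⟩
          obtain rfl : a = a' := by
            cases h : (decode n : Option β) <;> simp_all [Encodable.decode_prod_val]
          exact ⟨b, hp⟩
        · exact fun ⟨b, hb⟩ => ⟨encode b, (a, b), by simp, hb⟩

theorem rePred_mem_image {g : α → ℕ → ℕ} (hg : Primrec₂ g) {s : α → Set ℕ}
    (hs : REPred fun x : α × ℕ => x.2 ∈ s x.1) :
    REPred fun x : α × ℕ => x.2 ∈ g x.1 '' s x.1 := by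
  have hmem : REPred fun x : (α × ℕ) × ℕ => x.2 ∈ s x.1.1 :=
    rePred_comp hs ((Computable.fst.comp Computable.fst).pair Computable.snd)
  have heq : PrimrecPred fun x : (α × ℕ) × ℕ => g x.1.1 x.2 = x.1.2 :=
    Primrec.eq.comp (hg.comp (Primrec.fst.comp Primrec.fst) Primrec.snd)
      (Primrec.snd.comp Primrec.fst)
  exact rePred_exists (rePred_and hmem heq.computablePred.to_re)

theorem exists_computable_index {φ : ℕ → ℕ →. ℕ}
    (hφ : ∀ ψ : ℕ → ℕ →. ℕ, Partrec₂ ψ → ∃ f : ℕ → ℕ, Computable f ∧ ∀ p, φ (f p) = ψ p)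
    {L : α → Set ℕ} (hL : REPred fun x : α × ℕ => x.2 ∈ L x.1) :
    ∃ f : α → ℕ, Computable f ∧ ∀ a, W φ (f a) = L a := by
  have hψ : Partrec₂ fun p y : ℕ => (↑(decode p : Option α) : Part α).bind fun a =>
      (Part.assert (y ∈ L a) fun _ => Part.some ()).map fun _ => 0 := by
    refine Partrec.bind (Computable.decode.comp Computable.fst).ofOption (Partrec.map
      (hL.comp (Computable.snd.pair (Computable.snd.comp Computable.fst))) ?_)
    exact (Computable.const 0).to₂
  obtain ⟨f, hf, hfψ⟩ := hφ _ hψ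
  refine ⟨fun a => f (encode a), hf.comp Computable.encode, fun a => Set.ext fun y => ?_⟩
  simp [W, hfψ, Part.assert]

end RecursivelyEnumerable

section IterativeLearner

variable {α : Type*}

/-- The memory of an iterative learner, which remembers nothing but its last hypothesis (`none`
before the first one), after `t` data of the text `T`. -/
def memory (step : Option α → Datum → Option α) (T : ℕ → Datum) : ℕ → Option α
  | 0 => none
  | t + 1 => step (memory step T t) (T t)

theorem memory_eq_of_fixed {step : Option α → Datum → Option α} {T : ℕ → Datum} {s : ℕ}
    {p : Option α} (hs : memory step T s = p) (hfix : ∀ t ≥ s, step p (T t) = p) :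
    ∀ t ≥ s, memory step T t = p :=
  Nat.le_induction hs fun t ht ih => by rw [memory, ih, hfix t ht]

theorem finite_range_of_eventually_eq {u : ℕ → α} {t₀ : ℕ} {a : α} (h : ∀ t ≥ t₀, u t = a) :
    (Set.range u).Finite := by
  refine (((Set.finite_Iio t₀).image u).insert a).subset ?_
  rintro _ ⟨t, rfl⟩
  rcases lt_or_ge t t₀ with ht | ht
  · exact .inr ⟨t, ht, rfl⟩
  · exact .inl (h t ht)

theorem initSeg_succ (T : ℕ → Datum) (t : ℕ) : initSeg T (t + 1) = initSeg T t ++ [T t] := by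
  simp [initSeg, List.range_succ]

variable [Primcodable α] {step : Option α → Datum → Option α} {f : α → ℕ}

/-- The iterative learner on hypotheses of type `α` with update function `step`, conjecturing
the index `f a` for the hypothesis `a`. Its states are the codes of its memory. -/
def iterativeLearner (hstep : Computable₂ step) (hf : Computable f) : BMSLearner where
  hyp q x := Part.some ((step ((decode q).getD none) x).map f)
  trans q x := Part.some (encode (step ((decode q).getD none) x))
  hyp_partrec :=
    (Computable.option_map (hstep.comp (Computable.option_getD
      (Computable.decode.comp Computable.fst) (Computable.const none)) Computable.snd)
      (hf.comp Computable.snd).to₂).partrec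
  trans_partrec :=
    (Computable.encode.comp (hstep.comp (Computable.option_getD
      (Computable.decode.comp Computable.fst) (Computable.const none)) Computable.snd)).partrec
  dom_eq _ _ := Iff.rfl

variable (hstep : Computable₂ step) (hf : Computable f) (T : ℕ → Datum)

theorem iterativeLearner_state (t : ℕ) :
    (iterativeLearner hstep hf).state (initSeg T t) = Part.some (encode (memory step T t)) := by
  induction t with
  | zero => rfl
  | succ t ih =>
    rw [initSeg_succ, BMSLearner.state_append, ih, Part.bind_some]
    simp [iterativeLearner, memory]

theorem iterativeLearner_isLearningSeq :
    (iterativeLearner hstep hf).IsLearningSeq T fun t => (memory step T t).map f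
  | 0 => Part.mem_some _
  | t + 1 => by
    rw [initSeg_succ, BMSLearner.output_append, iterativeLearner_state, Part.bind_some]
    simp [iterativeLearner, memory]

theorem mem_txtBMSEx_sMon_of_iterative {φ : ℕ → ℕ →. ℕ} {lang : α → Set ℕ} {𝓛 : Set (Set ℕ)}
    (hstep : Computable₂ step) (hf : Computable f) (hlang : ∀ a, W φ (f a) = lang a)
    (hre : ∀ L ∈ 𝓛, REPred fun n => n ∈ L)
    (hmono : ∀ L ∈ 𝓛, ∀ T, IsTextFor T L → ∀ s t, s ≤ t → ∀ a b,
      memory step T s = some a → memory step T t = some b → lang a ⊆ lang b)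
    (hconv : ∀ L ∈ 𝓛, ∀ T, IsTextFor T L →
      ∃ a, lang a = L ∧ ∃ t₀, ∀ t ≥ t₀, memory step T t = some a) :
    𝓛 ∈ TxtBMSEx φ (SMon φ) := by
  refine ⟨hre, iterativeLearner hstep hf, fun L hL T hT => ?_⟩
  obtain ⟨a, ha, t₀, ht₀⟩ := hconv L hL T hT
  refine ⟨_, iterativeLearner_isLearningSeq hstep hf T, ?_, ?_, ?_⟩
  · refine ((finite_range_of_eventually_eq ht₀).image encode).subset ?_
    rintro q ⟨t, hq⟩
    rw [iterativeLearner_state, Part.mem_some_iff] at hq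
    exact ⟨_, ⟨t, rfl⟩, hq.symm⟩
  · intro s t hst d e hd he
    obtain ⟨a, ha, rfl⟩ := Option.map_eq_some_iff.1 hd
    obtain ⟨b, hb, rfl⟩ := Option.map_eq_some_iff.1 he
    simpa only [hlang] using hmono L hL T hT s t hst a b ha hb
  · refine ⟨t₀, f a, by simp [ht₀], by rw [hlang, ha], fun t ht _ => ?_⟩
    simp only [ht₀ t ht, ht₀ t₀ le_rfl]

end IterativeLearner

open Filter

section Runs

/-- The configuration of the machine `c` after it has read the data `σ`, starting from the
configuration `0`. -/
def run (c : Code) (σ : List Datum) : Part ℕ :=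
  σ.foldl (fun s x => s.bind fun z => c.eval (encode (z, x))) (Part.some 0)

/-- The approximation of `run c σ` that grants every single transition the fuel `u`. -/
def runWithin (u : ℕ) (c : Code) (σ : List Datum) : Option ℕ :=
  σ.foldl (fun s x => s.bind fun z => c.evaln u (encode (z, x))) (some 0)

/-- A machine that simulates a learner uses as its configurations the codes of pairs consisting
of the state of the learner and of its last hypothesis; this is the second component. -/
def currentHyp (z : ℕ) : Conjecture := (Denumerable.ofNat (ℕ × Conjecture) z).2

/-- The last hypothesis of the machine `c` after it has read the data `σ`. -/
def hypAfter (c : Code) (σ : List Datum) : Part Conjecture :=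
  (run c σ).map currentHyp

variable {c : Code} {σ σ' τ : List Datum} {u z : ℕ}

theorem run_concat (c : Code) (σ : List Datum) (x : Datum) :
    run c (σ ++ [x]) = (run c σ).bind fun z => c.eval (encode (z, x)) := by
  simp [run]

theorem runWithin_concat (u : ℕ) (c : Code) (σ : List Datum) (x : Datum) :
    runWithin u c (σ ++ [x]) = (runWithin u c σ).bind fun z => c.evaln u (encode (z, x)) := by
  simp [runWithin]

theorem run_append_congr (h : run c σ = run c σ') (τ : List Datum) :
    run c (σ ++ τ) = run c (σ' ++ τ) := by
  simp only [run, List.foldl_append] at h ⊢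
  rw [h]

theorem hypAfter_congr (h : run c σ = run c σ') : hypAfter c σ = hypAfter c σ' := by
  rw [hypAfter, h, hypAfter]

theorem run_dom_of_append (h : (run c (σ ++ τ)).Dom) : (run c σ).Dom := by
  induction τ using List.reverseRecOn with
  | nil => simpa using h
  | append_singleton τ x ih =>
    rw [← List.append_assoc, run_concat] at h
    exact ih h.of_bind

theorem runWithin_isSome_of_append (h : (runWithin u c (σ ++ τ)).isSome) :
    (runWithin u c σ).isSome := by
  induction τ using List.reverseRecOn with
  | nil => simpa using h
  | append_singleton τ x ih =>
    rw [← List.append_assoc, runWithin_concat] at h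
    exact ih (Option.isSome_of_isSome_bind h)

theorem mem_run_of_runWithin (h : z ∈ runWithin u c σ) : z ∈ run c σ := by
  induction σ using List.reverseRecOn generalizing z with
  | nil => simpa [run, runWithin, eq_comm] using h
  | append_singleton σ x ih =>
    rw [runWithin_concat] at h
    obtain ⟨y, hy, hz⟩ := Option.bind_eq_some_iff.1 h
    rw [run_concat]
    exact Part.mem_bind (ih hy) (Code.evaln_sound hz)

theorem eventually_runWithin_eq_some (h : z ∈ run c σ) :
    ∀ᶠ u in atTop, runWithin u c σ = some z := by
  induction σ using List.reverseRecOn generalizing z with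
  | nil => exact Eventually.of_forall fun u => by simpa [run, runWithin, eq_comm] using h
  | append_singleton σ x ih =>
    rw [run_concat] at h
    obtain ⟨y, hy, hz⟩ := Part.mem_bind_iff.1 h
    obtain ⟨k, hk⟩ := Code.evaln_complete.1 hz
    filter_upwards [ih hy, eventually_ge_atTop k] with u hu hku
    rw [runWithin_concat, hu]
    exact Code.evaln_mono hku hk

theorem exists_runWithin_isSome_iff :
    (∃ u, (runWithin u c σ).isSome) ↔ (run c σ).Dom := by
  constructor
  · rintro ⟨u, hu⟩
    exact Part.dom_iff_mem.2 ⟨_, mem_run_of_runWithin (Option.get_mem hu)⟩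
  · intro h
    obtain ⟨u, hu⟩ := (eventually_runWithin_eq_some (Part.get_mem h)).exists
    exact ⟨u, by simp [hu]⟩

theorem run_eq_runWithin (h : (runWithin u c σ).isSome) : run c σ = ↑(runWithin u c σ) := by
  obtain ⟨z, hz⟩ := Option.isSome_iff_exists.1 h
  rw [hz, Part.coe_some, Part.eq_some_iff]
  exact mem_run_of_runWithin hz

theorem eventually_run_eq_runWithin (h : (run c σ).Dom) :
    ∀ᶠ u in atTop, run c σ = ↑(runWithin u c σ) := by
  filter_upwards [eventually_runWithin_eq_some (Part.get_mem h)] with u hu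
  rw [hu, Part.coe_some, Part.some_get]

theorem ofOption_inj {α : Type*} {o o' : Option α} : (o : Part α) = o' ↔ o = o' := by
  rw [Part.ext_iff, Option.ext_iff]
  simp only [Part.mem_ofOption, Option.mem_def]

theorem runWithin_eq_iff (h : run c σ = ↑(runWithin u c σ)) (h' : run c σ' = ↑(runWithin u c σ')) :
    runWithin u c σ = runWithin u c σ' ↔ run c σ = run c σ' := by
  rw [h, h', ofOption_inj]

theorem map_runWithin_eq_iff (h : run c σ = ↑(runWithin u c σ))
    (h' : run c σ' = ↑(runWithin u c σ')) :
    (runWithin u c σ).map currentHyp = (runWithin u c σ').map currentHyp ↔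
      hypAfter c σ = hypAfter c σ' := by
  rw [hypAfter, hypAfter, h, h', ← ofOption_inj]
  cases runWithin u c σ <;> cases runWithin u c σ' <;> simp

theorem primrec_runWithin {α : Type*} [Primcodable α] {u : α → ℕ} {c : α → Code}
    {σ : α → List Datum} (hu : Primrec u) (hc : Primrec c) (hσ : Primrec σ) :
    Primrec fun a => runWithin (u a) (c a) (σ a) := by
  refine Primrec.list_foldl (h := fun a (sx : Option ℕ × Datum) =>
    sx.1.bind fun z => (c a).evaln (u a) (encode (z, sx.2))) hσ (Primrec.const (some 0)) ?_
  refine Primrec.option_bind (Primrec.fst.comp Primrec.snd) ?_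
  have hfst := Primrec.fst.comp (Primrec.fst (α := α × Option ℕ × Datum) (β := ℕ))
  exact Code.primrec_evaln.comp (((hu.comp hfst).pair (hc.comp hfst)).pair
    (Primrec.encode.comp (Primrec.snd.pair
      (Primrec.snd.comp (Primrec.snd.comp Primrec.fst)))))

theorem primrec_currentHyp : Primrec currentHyp :=
  Primrec.snd.comp (Primrec.ofNat (ℕ × Conjecture))

end Runs

section Languages

/-- The `i`-th point of the chain built against the machine `c`. -/
def point (c : Code) (i : ℕ) : ℕ := encode (c, (Sum.inl i : ℕ ⊕ ℕ))

/-- The marker announcing that the chain built against the machine `c` is left at its `k`-th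
point. -/
def marker (c : Code) (k : ℕ) : ℕ := encode (c, (Sum.inr k : ℕ ⊕ ℕ))

/-- The data presenting the first `n` points of the chain in order. -/
def points (c : Code) (n : ℕ) : List Datum := (List.range n).map fun i => some (point c i)

/-- The data with which the machine `c` is probed: the first `m` points of the chain, the marker of
`k`, and `r` pauses. -/
def probe (c : Code) (m k r : ℕ) : List Datum :=
  points c m ++ some (marker c k) :: (List.range r).map fun _ => none

/-- The machine `c` is in a configuration after the first `n` points that it did not have before. -/
def IsNew (c : Code) (n : ℕ) : Prop :=
  (run c (points c n)).Dom ∧ ∀ j < n, run c (points c j) ≠ run c (points c n)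

/-- After the marker of `k` and `r` pauses, the machine `c` is in a configuration to which `s + 1`
further pauses lead back, whereas the first `j` points change its hypothesis. -/
structure Reaction (c : Code) (k r s j : ℕ) : Prop where
  dom : (run c (probe c k k r ++ points c j)).Dom
  loop : run c (probe c k k (r + s + 1)) = run c (probe c k k r)
  hyp_ne : hypAfter c (probe c k k r ++ points c j) ≠ hypAfter c (probe c k k r)

/-- The machine `c` has some reaction to the marker of `k`. -/
def Reacts (c : Code) (k : ℕ) : Prop := ∃ r s j, Reaction c k r s j

/-- The approximation of `Reaction` by computations with fuel `u`. -/
structure ReactionWithin (u : ℕ) (c : Code) (k r s j : ℕ) : Prop where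
  isSome : (runWithin u c (probe c k k r ++ points c j)).isSome
  loop : runWithin u c (probe c k k (r + s + 1)) = runWithin u c (probe c k k r)
  hyp_ne : (runWithin u c (probe c k k r ++ points c j)).map currentHyp ≠
    (runWithin u c (probe c k k r)).map currentHyp

/-- A reaction to the marker of `k` has been found by a search bounded by `u`. -/
def ReactsWithin (u : ℕ) (c : Code) (k : ℕ) : Prop :=
  ∃ r < u, ∃ s < u, ∃ j < u, ReactionWithin u c k r s j

/-- The chain left at `k` may be cut at `m`: the configuration after `k` points has recurred, and a
reaction has been found, with a search bound below `m` so that all its points precede the cut. -/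
def IsCut (c : Code) (k m : ℕ) : Prop :=
  k ≤ m ∧ run c (points c m) = run c (points c k) ∧ ∃ u < m, ReactsWithin u c k

/-- The `i`-th point of the chain left at `k` precedes every cut. -/
def Uncut (c : Code) (k i : ℕ) : Prop :=
  (run c (points c i)).Dom ∧ ∀ m ≤ i, ¬ IsCut c k m

/-- The points of the chain as long as the configurations of the machine `c` do not repeat. -/
def chainLang (c : Code) : Set ℕ := point c '' {i | ∃ n > i, IsNew c n}

/-- The chain left at `k`, continued up to the first cut. -/
def fullLang (c : Code) (k : ℕ) : Set ℕ :=
  insert (marker c k) (point c '' {i | i < k ∨ Uncut c k i})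

/-- The chain left at `k`, continued up to the first cut only if the machine `c` reacts. -/
def stubLang (c : Code) (k : ℕ) : Set ℕ :=
  insert (marker c k) (point c '' {i | i < k ∨ Uncut c k i ∧ Reacts c k})

variable {c : Code} {i j k m n r s u : ℕ}

theorem points_prefix (c : Code) (h : m ≤ n) : points c m <+: points c n := by
  obtain ⟨d, rfl⟩ := Nat.exists_eq_add_of_le h
  rw [points, points, List.range_add, List.map_append]
  exact List.prefix_append _ _

theorem run_points_dom_of_le (h : m ≤ n) (hn : (run c (points c n)).Dom) :
    (run c (points c m)).Dom := by
  obtain ⟨τ, hτ⟩ := points_prefix c h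
  exact run_dom_of_append (τ := τ) (by rwa [hτ])

theorem run_points_eq_runWithin_of_le (h : m ≤ n) (hn : (runWithin u c (points c n)).isSome) :
    run c (points c m) = ↑(runWithin u c (points c m)) := by
  obtain ⟨τ, hτ⟩ := points_prefix c h
  exact run_eq_runWithin (runWithin_isSome_of_append (τ := τ) (by rwa [hτ]))

theorem isNew_iff : IsNew c n ↔ ∃ u, (runWithin u c (points c n)).isSome ∧
    ∀ j < n, runWithin u c (points c j) ≠ runWithin u c (points c n) := by
  rw [IsNew, ← exists_runWithin_isSome_iff, ← exists_and_right]
  refine exists_congr fun u => and_congr_right fun hu => forall₂_congr fun j hj => not_congr ?_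
  exact (runWithin_eq_iff (run_points_eq_runWithin_of_le hj.le hu)
    (run_points_eq_runWithin_of_le le_rfl hu)).symm

theorem uncut_iff : Uncut c k i ↔ ∃ u, (runWithin u c (points c i)).isSome ∧
    ∀ m < i + 1, ¬ (k ≤ m ∧ runWithin u c (points c m) = runWithin u c (points c k) ∧
      ∃ v < m, ReactsWithin v c k) := by
  rw [Uncut, ← exists_runWithin_isSome_iff, ← exists_and_right]
  refine exists_congr fun u => and_congr_right fun hu => ?_
  simp only [Nat.lt_succ_iff, IsCut]
  refine forall₂_congr fun m hm => not_congr (and_congr_right fun hkm => and_congr_left' ?_)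
  exact (runWithin_eq_iff (run_points_eq_runWithin_of_le hm hu)
    (run_points_eq_runWithin_of_le (hkm.trans hm) hu)).symm

theorem ReactionWithin.reaction (h : ReactionWithin u c k r s j) : Reaction c k r s j := by
  have hr := runWithin_isSome_of_append h.isSome
  have hs : (runWithin u c (probe c k k (r + s + 1))).isSome := h.loop ▸ hr
  exact ⟨exists_runWithin_isSome_iff.1 ⟨u, h.isSome⟩,
    (runWithin_eq_iff (run_eq_runWithin hs) (run_eq_runWithin hr)).1 h.loop,
    mt (map_runWithin_eq_iff (run_eq_runWithin h.isSome) (run_eq_runWithin hr)).2 h.hyp_ne⟩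

theorem Reaction.eventually_reactionWithin (h : Reaction c k r s j) :
    ∀ᶠ u in atTop, ReactionWithin u c k r s j := by
  have hr := run_dom_of_append h.dom
  filter_upwards [eventually_runWithin_eq_some (Part.get_mem h.dom),
    eventually_run_eq_runWithin h.dom, eventually_run_eq_runWithin hr,
    eventually_run_eq_runWithin (h.loop ▸ hr)] with u huj hj hr hs
  exact ⟨by simp [huj], (runWithin_eq_iff hs hr).2 h.loop,
    mt (map_runWithin_eq_iff hj hr).1 h.hyp_ne⟩

theorem reacts_iff : Reacts c k ↔ ∃ u, ReactsWithin u c k := by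
  constructor
  · rintro ⟨r, s, j, h⟩
    obtain ⟨u, hu, hr, hs, hj⟩ := (h.eventually_reactionWithin.and ((eventually_gt_atTop r).and
      ((eventually_gt_atTop s).and (eventually_gt_atTop j)))).exists
    exact ⟨u, r, hr, s, hs, j, hj, hu⟩
  · rintro ⟨u, r, -, s, -, j, -, h⟩
    exact ⟨r, s, j, h.reaction⟩

section Enumeration

variable {α : Type*} [Primcodable α] {f : α → Code} {g h : α → ℕ}

theorem primrecPred_exists_lt {R : ℕ → α → Prop} (hR : PrimrecRel R) (hg : Primrec g) :
    PrimrecPred fun a => ∃ x < g a, R x a :=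
  (PrimrecRel.comp hR.exists_mem_list (Primrec.list_range.comp hg) Primrec.id).of_eq (by simp)

theorem primrecPred_forall_lt {R : ℕ → α → Prop} (hR : PrimrecRel R) (hg : Primrec g) :
    PrimrecPred fun a => ∀ x < g a, R x a :=
  (PrimrecRel.comp hR.forall_mem_list (Primrec.list_range.comp hg) Primrec.id).of_eq (by simp)

theorem primrec_point (hf : Primrec f) (hg : Primrec g) : Primrec fun a => point (f a) (g a) :=
  Primrec.encode.comp (hf.pair (Primrec.sumInl.comp hg))

theorem primrec_marker (hf : Primrec f) (hg : Primrec g) : Primrec fun a => marker (f a) (g a) :=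
  Primrec.encode.comp (hf.pair (Primrec.sumInr.comp hg))

theorem primrec_points (hf : Primrec f) (hg : Primrec g) :
    Primrec fun a => points (f a) (g a) :=
  Primrec.list_map (Primrec.list_range.comp hg)
    (Primrec.option_some.comp (primrec_point (hf.comp Primrec.fst) Primrec.snd))

theorem primrec_probe {m : α → ℕ} (hf : Primrec f) (hm : Primrec m) (hg : Primrec g)
    (hh : Primrec h) : Primrec fun a => probe (f a) (m a) (g a) (h a) :=
  Primrec.list_append.comp (primrec_points hf hm) (Primrec.list_cons.comp
    (Primrec.option_some.comp (primrec_marker hf hg))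
    (Primrec.list_map (Primrec.list_range.comp hh) (Primrec.const none)))

theorem primrecPred_reactionWithin {u r s j : α → ℕ} (hu : Primrec u) (hf : Primrec f)
    (hg : Primrec g) (hr : Primrec r) (hs : Primrec s) (hj : Primrec j) :
    PrimrecPred fun a => ReactionWithin (u a) (f a) (g a) (r a) (s a) (j a) := by
  have hprobe := primrec_probe hf hg hg hr
  have hfast := primrec_runWithin hu hf hprobe
  have hloop := primrec_runWithin hu hf (primrec_probe hf hg hg
    (Primrec.succ.comp (Primrec.nat_add.comp hr hs)))
  have hslow := primrec_runWithin hu hf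
    (Primrec.list_append.comp hprobe (primrec_points hf hj))
  have hhyp : Primrec₂ fun (_ : α) z => currentHyp z := primrec_currentHyp.comp Primrec.snd
  exact ((Primrec.eq.comp (Primrec.option_isSome.comp hslow) (Primrec.const true)).and
    ((Primrec.eq.comp hloop hfast).and (PrimrecPred.not (Primrec.eq.comp
    (Primrec.option_map hslow hhyp) (Primrec.option_map hfast hhyp))))).of_eq
    fun _ => ⟨fun ⟨h₁, h₂, h₃⟩ => ⟨h₁, h₂, h₃⟩, fun ⟨h₁, h₂, h₃⟩ => ⟨h₁, h₂, h₃⟩⟩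

theorem primrecPred_reactsWithin {u : α → ℕ} (hu : Primrec u) (hf : Primrec f) (hg : Primrec g) :
    PrimrecPred fun a => ReactsWithin (u a) (f a) (g a) := by
  have hbase : Primrec fun x : ℕ × ℕ × ℕ × α => x.2.2.2 :=
    Primrec.snd.comp (Primrec.snd.comp Primrec.snd)
  have hj : PrimrecRel fun (j : ℕ) (x : ℕ × ℕ × α) =>
      ReactionWithin (u x.2.2) (f x.2.2) (g x.2.2) x.2.1 x.1 j :=
    primrecPred_reactionWithin (hu.comp hbase) (hf.comp hbase) (hg.comp hbase)
      (Primrec.fst.comp (Primrec.snd.comp Primrec.snd)) (Primrec.fst.comp Primrec.snd)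
      Primrec.fst
  have hs : PrimrecRel fun (s : ℕ) (x : ℕ × α) => ∃ j < u x.2,
      ReactionWithin (u x.2) (f x.2) (g x.2) x.1 s j :=
    primrecPred_exists_lt hj (hu.comp (Primrec.snd.comp Primrec.snd))
  have hr : PrimrecRel fun (r : ℕ) (a : α) => ∃ s < u a, ∃ j < u a,
      ReactionWithin (u a) (f a) (g a) r s j :=
    primrecPred_exists_lt hs (hu.comp Primrec.snd)
  exact primrecPred_exists_lt hr hu

theorem rePred_reacts : REPred fun x : Code × ℕ => Reacts x.1 x.2 := by
  have h : PrimrecRel fun (x : Code × ℕ) u => ReactsWithin u x.1 x.2 :=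
    primrecPred_reactsWithin Primrec.snd (Primrec.fst.comp Primrec.fst)
      (Primrec.snd.comp Primrec.fst)
  exact (rePred_exists_of_primrecRel h).of_eq fun _ => reacts_iff.symm

theorem primrec_runWithin_points {u n : α → ℕ} (hu : Primrec u) (hf : Primrec f)
    (hn : Primrec n) : Primrec fun a => runWithin (u a) (f a) (points (f a) (n a)) :=
  primrec_runWithin hu hf (primrec_points hf hn)

theorem rePred_isNew : REPred fun x : Code × ℕ => IsNew x.1 x.2 := by
  have hc : Primrec fun y : (Code × ℕ) × ℕ => y.1.1 := Primrec.fst.comp Primrec.fst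
  have hn : Primrec fun y : (Code × ℕ) × ℕ => y.1.2 := Primrec.snd.comp Primrec.fst
  have hne : PrimrecRel fun (j : ℕ) (y : (Code × ℕ) × ℕ) =>
      runWithin y.2 y.1.1 (points y.1.1 j) ≠ runWithin y.2 y.1.1 (points y.1.1 y.1.2) :=
    have hu := Primrec.snd.comp (Primrec.snd (α := ℕ) (β := (Code × ℕ) × ℕ))
    PrimrecPred.not (Primrec.eq.comp
      (primrec_runWithin_points hu (hc.comp Primrec.snd) Primrec.fst)
      (primrec_runWithin_points hu (hc.comp Primrec.snd) (hn.comp Primrec.snd)))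
  have hisNew : PrimrecRel fun (x : Code × ℕ) u =>
      (runWithin u x.1 (points x.1 x.2)).isSome = true ∧
      ∀ j < x.2, runWithin u x.1 (points x.1 j) ≠ runWithin u x.1 (points x.1 x.2) :=
    (Primrec.eq.comp (Primrec.option_isSome.comp (primrec_runWithin_points Primrec.snd hc hn))
      (Primrec.const true)).and (primrecPred_forall_lt hne hn)
  exact (rePred_exists_of_primrecRel hisNew).of_eq fun _ => isNew_iff.symm

theorem rePred_uncut : REPred fun x : (Code × ℕ) × ℕ => Uncut x.1.1 x.1.2 x.2 := by
  have hc : Primrec fun y : ((Code × ℕ) × ℕ) × ℕ => y.1.1.1 :=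
    Primrec.fst.comp (Primrec.fst.comp Primrec.fst)
  have hk : Primrec fun y : ((Code × ℕ) × ℕ) × ℕ => y.1.1.2 :=
    Primrec.snd.comp (Primrec.fst.comp Primrec.fst)
  have hi : Primrec fun y : ((Code × ℕ) × ℕ) × ℕ => y.1.2 := Primrec.snd.comp Primrec.fst
  have hreacts : PrimrecRel fun (v : ℕ) (y : ℕ × ((Code × ℕ) × ℕ) × ℕ) =>
      ReactsWithin v y.2.1.1.1 y.2.1.1.2 :=
    primrecPred_reactsWithin Primrec.fst (hc.comp (Primrec.snd.comp Primrec.snd))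
      (hk.comp (Primrec.snd.comp Primrec.snd))
  have hcut : PrimrecRel fun (m : ℕ) (y : ((Code × ℕ) × ℕ) × ℕ) => ¬ (y.1.1.2 ≤ m ∧
      runWithin y.2 y.1.1.1 (points y.1.1.1 m) = runWithin y.2 y.1.1.1 (points y.1.1.1 y.1.1.2) ∧
      ∃ v < m, ReactsWithin v y.1.1.1 y.1.1.2) :=
    have hu := Primrec.snd.comp (Primrec.snd (α := ℕ) (β := ((Code × ℕ) × ℕ) × ℕ))
    have hc' := hc.comp (Primrec.snd (α := ℕ))
    have hk' := hk.comp (Primrec.snd (α := ℕ))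
    PrimrecPred.not ((Primrec.nat_le.comp hk' Primrec.fst).and ((Primrec.eq.comp
      (primrec_runWithin_points hu hc' Primrec.fst) (primrec_runWithin_points hu hc' hk')).and
      (primrecPred_exists_lt hreacts Primrec.fst)))
  have huncut : PrimrecRel fun (x : (Code × ℕ) × ℕ) u =>
      (runWithin u x.1.1 (points x.1.1 x.2)).isSome = true ∧ ∀ m < x.2 + 1,
        ¬ (x.1.2 ≤ m ∧ runWithin u x.1.1 (points x.1.1 m) = runWithin u x.1.1 (points x.1.1 x.1.2) ∧
          ∃ v < m, ReactsWithin v x.1.1 x.1.2) :=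
    (Primrec.eq.comp (Primrec.option_isSome.comp (primrec_runWithin_points Primrec.snd hc hi))
      (Primrec.const true)).and (primrecPred_forall_lt hcut (Primrec.succ.comp hi))
  exact (rePred_exists_of_primrecRel huncut).of_eq fun _ => uncut_iff.symm

theorem rePred_chainLang : REPred fun x : Code × ℕ => x.2 ∈ chainLang x.1 := by
  have hlt : PrimrecPred fun y : (Code × ℕ) × ℕ => y.1.2 < y.2 :=
    Primrec.nat_lt.comp (Primrec.snd.comp Primrec.fst) Primrec.snd
  have hnew : REPred fun y : (Code × ℕ) × ℕ => IsNew y.1.1 y.2 :=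
    rePred_comp rePred_isNew
      (((Primrec.fst.comp Primrec.fst).pair Primrec.snd).to_comp)
  exact rePred_mem_image (s := fun c => {i | ∃ n > i, IsNew c n})
    (primrec_point Primrec.fst Primrec.snd)
    (rePred_exists (rePred_and hlt.computablePred.to_re hnew))

theorem rePred_insert_marker_image_point {p : (Code × ℕ) × ℕ → Prop} (hp : REPred p) :
    REPred fun x : (Code × ℕ) × ℕ => x.2 ∈
      insert (marker x.1.1 x.1.2) (point x.1.1 '' {i | i < x.1.2 ∨ p (x.1, i)}) := by
  have hlt : PrimrecPred fun y : (Code × ℕ) × ℕ => y.2 < y.1.2 :=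
    Primrec.nat_lt.comp Primrec.snd (Primrec.snd.comp Primrec.fst)
  have hindex : REPred fun x : (Code × ℕ) × ℕ => x.2 ∈ {i | i < x.1.2 ∨ p (x.1, i)} :=
    rePred_or hlt.computablePred.to_re hp
  have hpoint : Primrec₂ fun x : Code × ℕ => point x.1 :=
    primrec_point (Primrec.fst.comp Primrec.fst) Primrec.snd
  have himage := rePred_mem_image (s := fun x => {i | i < x.2 ∨ p (x, i)}) hpoint hindex
  have hmarker : PrimrecPred fun x : (Code × ℕ) × ℕ => x.2 = marker x.1.1 x.1.2 :=
    Primrec.eq.comp Primrec.snd (primrec_marker (Primrec.fst.comp Primrec.fst)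
      (Primrec.snd.comp Primrec.fst))
  exact rePred_or hmarker.computablePred.to_re himage

theorem rePred_fullLang : REPred fun x : (Code × ℕ) × ℕ => x.2 ∈ fullLang x.1.1 x.1.2 :=
  rePred_insert_marker_image_point rePred_uncut

theorem rePred_stubLang : REPred fun x : (Code × ℕ) × ℕ => x.2 ∈ stubLang x.1.1 x.1.2 :=
  rePred_insert_marker_image_point
    (rePred_and rePred_uncut (rePred_comp rePred_reacts Computable.fst))

end Enumeration

end Languages

section Learner

/-- The hypotheses of the strongly monotonic learner: the codes of the languages `chainLang c`,
`stubLang c k` and `fullLang c k`, in this order. -/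
abbrev Hypothesis : Type := Code ⊕ (Code × ℕ) ⊕ (Code × ℕ)

namespace Hypothesis

/-- The hypothesis `chainLang c`. -/
abbrev chain (c : Code) : Hypothesis := .inl c

/-- The hypothesis `stubLang c k`. -/
abbrev stub (c : Code) (k : ℕ) : Hypothesis := .inr (.inl (c, k))

/-- The hypothesis `fullLang c k`. -/
abbrev full (c : Code) (k : ℕ) : Hypothesis := .inr (.inr (c, k))

/-- The language of a hypothesis. -/
def lang : Hypothesis → Set ℕ
  | .inl c => chainLang c
  | .inr (.inl (c, k)) => stubLang c k
  | .inr (.inr (c, k)) => fullLang c k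

/-- The revision of a hypothesis at the `i`-th point of its chain: it extends a stub left at
`k ≤ i`. -/
def atPoint (i : ℕ) : Hypothesis → Hypothesis
  | .inr (.inl (c, k)) => if k ≤ i then full c k else stub c k
  | a => a

/-- The revision of a hypothesis at the marker of `k`: it leaves the chain. -/
def atMarker (k : ℕ) : Hypothesis → Hypothesis
  | .inl c => stub c k
  | a => a

end Hypothesis

open Hypothesis

/-- The update function of the strongly monotonic learner, which starts with the chain that its
first datum belongs to. -/
def update (p : Option Hypothesis) (x : Datum) : Option Hypothesis :=
  (x.bind (decode (α := Code × (ℕ ⊕ ℕ)))).elim p fun d =>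
    some (d.2.elim (fun i => (p.getD (chain d.1)).atPoint i) fun k =>
      (p.getD (chain d.1)).atMarker k)

theorem update_none (p : Option Hypothesis) : update p none = p := rfl

theorem update_point (p : Option Hypothesis) (c : Code) (i : ℕ) :
    update p (some (point c i)) = some ((p.getD (chain c)).atPoint i) := by
  rw [update, Option.bind_some, point, encodek]; rfl

theorem update_marker (p : Option Hypothesis) (c : Code) (k : ℕ) :
    update p (some (marker c k)) = some ((p.getD (chain c)).atMarker k) := by
  rw [update, Option.bind_some, marker, encodek]; rfl

section Computability

variable {α : Type*} [Primcodable α] {n : α → ℕ} {a : α → Hypothesis}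

theorem primrec_atPoint (hn : Primrec n) (ha : Primrec a) :
    Primrec fun x => (a x).atPoint (n x) := by
  have hrevise : Primrec₂ fun (x : α) (y : Code × ℕ) =>
      if y.2 ≤ n x then full y.1 y.2 else stub y.1 y.2 :=
    Primrec.ite (Primrec.nat_le.comp (Primrec.snd.comp Primrec.snd) (hn.comp Primrec.fst))
      (Primrec.sumInr.comp (Primrec.sumInr.comp Primrec.snd))
      (Primrec.sumInr.comp (Primrec.sumInl.comp Primrec.snd))
  refine (Primrec.sumCasesOn ha (ha.comp Primrec.fst).to₂ (Primrec.sumCasesOn Primrec.snd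
    (hrevise.comp (Primrec.fst.comp Primrec.fst) Primrec.snd).to₂
    (ha.comp (Primrec.fst.comp Primrec.fst)).to₂).to₂).of_eq fun x => ?_
  rcases h : a x with c | c | c <;> simp [atPoint, h]

theorem primrec_atMarker (hn : Primrec n) (ha : Primrec a) :
    Primrec fun x => (a x).atMarker (n x) := by
  refine (Primrec.sumCasesOn ha (Primrec.sumInr.comp (Primrec.sumInl.comp
    (Primrec.snd.pair (hn.comp Primrec.fst)))).to₂ (ha.comp Primrec.fst).to₂).of_eq fun x => ?_
  rcases h : a x with c | c | c <;> simp [atMarker, h]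

theorem primrec_update : Primrec₂ update := by
  have hcur : Primrec fun z : (Option Hypothesis × Datum) × Code × (ℕ ⊕ ℕ) =>
      z.1.1.getD (chain z.2.1) :=
    Primrec.option_getD.comp (Primrec.fst.comp Primrec.fst)
      (Primrec.sumInl.comp (Primrec.fst.comp Primrec.snd))
  have hdatum : Primrec fun z : Option Hypothesis × Datum =>
      z.2.bind (decode (α := Code × (ℕ ⊕ ℕ))) :=
    Primrec.option_bind Primrec.snd (Primrec.decode.comp Primrec.snd)
  refine (Primrec.option_casesOn hdatum Primrec.fst (Primrec.option_some.comp
    (Primrec.sumCasesOn (Primrec.snd.comp Primrec.snd)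
      (primrec_atPoint Primrec.snd (hcur.comp Primrec.fst)).to₂
      (primrec_atMarker Primrec.snd (hcur.comp Primrec.fst)).to₂)).to₂).of_eq fun z => ?_
  rcases h : z.2.bind (decode (α := Code × (ℕ ⊕ ℕ))) with _ | ⟨c, i | k⟩ <;>
    simp only [update, h] <;> rfl

end Computability

variable {c : Code} {k : ℕ} {p : Option Hypothesis} {x : Datum} {T : ℕ → Datum}

theorem stubLang_subset_fullLang (c : Code) (k : ℕ) : stubLang c k ⊆ fullLang c k :=
  Set.insert_subset_insert (Set.image_mono fun _ => Or.imp_right And.left)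

/-- The language of the memory of the learner, empty before the first hypothesis. -/
def memoryLang (p : Option Hypothesis) : Set ℕ := p.elim ∅ lang

/-- All points of the chain built against `c`, and the marker of `k`. -/
def pool (c : Code) (k : ℕ) : Set ℕ := insert (marker c k) (Set.range (point c))

/-- The memories of the learner on texts over `pool c k`. -/
def poolMemories (c : Code) (k : ℕ) : Set (Option Hypothesis) :=
  {none, some (chain c), some (stub c k), some (full c k)}

theorem update_mem_poolMemories (hp : p ∈ poolMemories c k) (hx : ∀ n ∈ x, n ∈ pool c k) :
    update p x ∈ poolMemories c k := by
  rcases x with _ | n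
  · exact hp
  obtain rfl | ⟨i, rfl⟩ := hx n rfl <;> rcases hp with rfl | rfl | rfl | rfl <;>
    simp only [update_marker, update_point, Option.getD_none, Option.getD_some, atMarker, atPoint]
  case some.inr.inr.inr.inl => split_ifs <;> simp [poolMemories]
  all_goals simp [poolMemories]

theorem memoryLang_subset_update (hp : p ∈ poolMemories c k) (hx : ∀ n ∈ x, n ∈ pool c k)
    (hmarker : marker c k ∈ x → chainLang c ⊆ stubLang c k) :
    memoryLang p ⊆ memoryLang (update p x) := by
  rcases x with _ | n
  · exact subset_rfl
  obtain rfl | ⟨i, rfl⟩ := hx n rfl <;> rcases hp with rfl | rfl | rfl | rfl <;>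
    simp only [update_marker, update_point, Option.getD_none, Option.getD_some, atMarker, atPoint,
      memoryLang, Option.elim_none, Option.elim_some, Set.empty_subset, subset_rfl]
  · exact hmarker rfl
  · split_ifs
    exacts [stubLang_subset_fullLang c k, subset_rfl]

theorem memory_mem_poolMemories (hT : content T ⊆ pool c k) (t : ℕ) :
    memory update T t ∈ poolMemories c k := by
  induction t with
  | zero => exact .inl rfl
  | succ t ih => exact update_mem_poolMemories ih fun n hn => hT ⟨t, hn⟩

theorem monotone_memoryLang (hT : content T ⊆ pool c k)
    (hmarker : marker c k ∈ content T → chainLang c ⊆ stubLang c k) :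
    Monotone fun t => memoryLang (memory update T t) :=
  monotone_nat_of_le_succ fun t => memoryLang_subset_update (memory_mem_poolMemories hT t)
    (fun _ hn => hT ⟨t, hn⟩) fun h => hmarker ⟨t, h⟩

theorem eventually_chain (hT : content T ⊆ Set.range (point c)) (h0 : point c 0 ∈ content T) :
    ∃ t₀, ∀ t ≥ t₀, memory update T t = some (chain c) := by
  have hpoint : ∀ t, T t ≠ none → ∀ p, p = none ∨ p = some (chain c) →
      update p (T t) = some (chain c) := by
    intro t ht p hp
    obtain ⟨n, hn⟩ := Option.ne_none_iff_exists'.1 ht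
    obtain ⟨i, rfl⟩ := hT ⟨t, hn⟩
    rw [hn, update_point]
    rcases hp with rfl | rfl <;> rfl
  have hmem : ∀ t, memory update T t = none ∨ memory update T t = some (chain c) := by
    intro t
    induction t with
    | zero => exact .inl rfl
    | succ t ih =>
      by_cases ht : T t = none
      · rwa [memory, ht, update_none]
      · exact .inr (hpoint t ht _ ih)
  obtain ⟨s, hs⟩ := h0
  refine ⟨s + 1, memory_eq_of_fixed (hpoint s (by simp [hs]) _ (hmem s)) fun t _ => ?_⟩
  by_cases ht : T t = none
  · rw [ht, update_none]
  · exact hpoint t ht _ (.inr rfl)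

theorem update_full (hx : ∀ n ∈ x, n ∈ pool c k) :
    update (some (full c k)) x = some (full c k) := by
  rcases x with _ | n
  · rfl
  · obtain rfl | ⟨i, rfl⟩ := hx n rfl
    exacts [update_marker .., update_point ..]

theorem update_stub_of_le {i : ℕ} (hi : k ≤ i) :
    update (some (stub c k)) (some (point c i)) = some (full c k) := by
  rw [update_point, Option.getD_some, atPoint, if_pos hi]

theorem update_stub (hx : ∀ n ∈ x, n ∈ pool c k) (hk : ∀ i ≥ k, x ≠ some (point c i)) :
    update (some (stub c k)) x = some (stub c k) := by
  rcases x with _ | n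
  · rfl
  · obtain rfl | ⟨i, rfl⟩ := hx n rfl
    · exact update_marker ..
    · rw [update_point, Option.getD_some, atPoint, if_neg fun hi => hk i hi rfl]

theorem update_eq_full (hp : p ∈ poolMemories c k) (hx : ∀ n ∈ x, n ∈ pool c k)
    (hfull : update p x = some (full c k)) :
    p = some (full c k) ∨ ∃ i ≥ k, x = some (point c i) := by
  by_contra! h
  obtain ⟨hne, hk⟩ := h
  rcases hp with rfl | rfl | rfl | hp
  · rcases x with _ | n
    · simp [update_none] at hfull
    · obtain rfl | ⟨i, rfl⟩ := hx n rfl <;>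
        simp [update_marker, update_point, atMarker, atPoint] at hfull
  · rcases x with _ | n
    · simp [update_none] at hfull
    · obtain rfl | ⟨i, rfl⟩ := hx n rfl <;>
        simp [update_marker, update_point, atMarker, atPoint] at hfull
  · simp [update_stub hx hk] at hfull
  · exact hne hp

theorem update_marker_eq (hp : p ∈ poolMemories c k) :
    update p (some (marker c k)) = some (stub c k) ∨
      update p (some (marker c k)) = some (full c k) := by
  rcases hp with rfl | rfl | rfl | rfl <;> simp [update_marker, atMarker]

theorem eventually_stub_or_full (hT : content T ⊆ pool c k) (hmarker : marker c k ∈ content T) :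
    (∃ t₀, ∀ t ≥ t₀, memory update T t = some (stub c k)) ∨
      ∃ t₀, ∀ t ≥ t₀, memory update T t = some (full c k) := by
  by_cases hfull : ∃ s, memory update T s = some (full c k)
  · obtain ⟨s, hs⟩ := hfull
    exact .inr ⟨s, memory_eq_of_fixed hs fun t _ => update_full fun n hn => hT ⟨t, hn⟩⟩
  push Not at hfull
  obtain ⟨s, hs⟩ := hmarker
  refine .inl ⟨s + 1, Nat.le_induction ?_ fun t _ ih => ?_⟩
  · refine (hs ▸ update_marker_eq (memory_mem_poolMemories hT s)).resolve_right (hfull (s + 1))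
  · refine ih ▸ update_stub (fun n hn => hT ⟨t, hn⟩) fun i hi hti => hfull (t + 1) ?_
    rw [memory, ih, hti, update_stub_of_le hi]

theorem eventually_stub (hT : content T ⊆ pool c k) (hmarker : marker c k ∈ content T)
    (hk : ∀ i ≥ k, point c i ∉ content T) :
    ∃ t₀, ∀ t ≥ t₀, memory update T t = some (stub c k) := by
  have hne : ∀ t, memory update T t ≠ some (full c k) := by
    intro t
    induction t with
    | zero => exact (Option.some_ne_none _).symm
    | succ t ih =>
      intro hfull
      rcases update_eq_full (memory_mem_poolMemories hT t) (fun n hn => hT ⟨t, hn⟩) hfull with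
        h | ⟨i, hi, hti⟩
      exacts [ih h, hk i hi ⟨t, hti⟩]
  exact (eventually_stub_or_full hT hmarker).resolve_right fun ⟨t, ht⟩ => hne t (ht t le_rfl)

theorem exists_late_point (hpoints : ∀ i, point c i ∈ content T) (k t₀ : ℕ) :
    ∃ i ≥ k, ∃ t ≥ t₀, T t = some (point c i) := by
  choose time htime using hpoints
  have hinj : Function.Injective time := fun i j hij => by
    have h := (htime i).symm.trans (hij ▸ htime j)
    simpa [point] using h
  obtain ⟨i, hi, ht⟩ :=
    ((eventually_ge_atTop k).and (hinj.nat_tendsto_atTop.eventually_ge_atTop t₀)).exists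
  exact ⟨i, hi, time i, ht, htime i⟩

theorem eventually_full (hT : content T ⊆ pool c k) (hmarker : marker c k ∈ content T)
    (hpoints : ∀ i, point c i ∈ content T) :
    ∃ t₀, ∀ t ≥ t₀, memory update T t = some (full c k) := by
  refine (eventually_stub_or_full hT hmarker).resolve_left fun ⟨t₀, ht₀⟩ => ?_
  obtain ⟨i, hi, t, ht, hti⟩ := exists_late_point hpoints k t₀
  have hstub := ht₀ (t + 1) (by omega)
  rw [memory, ht₀ t ht, hti, update_stub_of_le hi] at hstub
  simp at hstub

/-- The languages of the class that separates the two learning criteria. -/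
inductive Separating : Set ℕ → Prop
  | chain (c : Code) (hpoints : ∀ i, point c i ∈ chainLang c) : Separating (chainLang c)
  | stub (c : Code) (k : ℕ) (hchain : chainLang c ⊆ stubLang c k)
      (hpoints : ∀ i ≥ k, point c i ∉ stubLang c k) : Separating (stubLang c k)
  | reacting (c : Code) (k : ℕ) (hchain : chainLang c ⊆ stubLang c k)
      (heq : stubLang c k = fullLang c k) : Separating (fullLang c k)
  | full (c : Code) (k : ℕ) (hchain : chainLang c ⊆ stubLang c k)
      (hpoints : ∀ i, point c i ∈ fullLang c k) : Separating (fullLang c k)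

theorem stubLang_subset_pool (c : Code) (k : ℕ) : stubLang c k ⊆ pool c k :=
  Set.insert_subset_insert (Set.image_subset_range _ _)

theorem fullLang_subset_pool (c : Code) (k : ℕ) : fullLang c k ⊆ pool c k :=
  Set.insert_subset_insert (Set.image_subset_range _ _)

theorem chainLang_subset_range (c : Code) : chainLang c ⊆ Set.range (point c) :=
  Set.image_subset_range _ _

theorem marker_notMem_range_point (c d : Code) (k : ℕ) : marker c k ∉ Set.range (point d) := by
  rintro ⟨i, hi⟩
  simpa using (Prod.ext_iff.1 (encode_injective hi)).2

theorem Separating.rePred {L : Set ℕ} (hL : Separating L) : REPred fun n => n ∈ L := by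
  cases hL with
  | chain c =>
    exact rePred_comp (f := fun n => (c, n)) rePred_chainLang
      ((Computable.const c).pair Computable.id)
  | stub c k =>
    exact rePred_comp (f := fun n => ((c, k), n)) rePred_stubLang
      ((Computable.const (c, k)).pair Computable.id)
  | reacting c k | full c k =>
    exact rePred_comp (f := fun n => ((c, k), n)) rePred_fullLang
      ((Computable.const (c, k)).pair Computable.id)

theorem Separating.exists_pool {L : Set ℕ} (hL : Separating L) : ∃ c k, L ⊆ pool c k ∧
    (marker c k ∈ L → chainLang c ⊆ stubLang c k) := by
  cases hL with
  | chain c =>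
    exact ⟨c, 0, (chainLang_subset_range c).trans (Set.subset_insert _ _),
      fun h => absurd (chainLang_subset_range c h) (marker_notMem_range_point c c 0)⟩
  | stub c k hchain => exact ⟨c, k, stubLang_subset_pool c k, fun _ => hchain⟩
  | reacting c k hchain | full c k hchain =>
    exact ⟨c, k, fullLang_subset_pool c k, fun _ => hchain⟩

theorem Separating.monotone {L : Set ℕ} (hL : Separating L) (hT : IsTextFor T L) :
    Monotone fun t => memoryLang (memory update T t) := by
  obtain rfl : content T = L := hT
  obtain ⟨c, k, hpool, hmarker⟩ := hL.exists_pool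
  exact monotone_memoryLang hpool hmarker

theorem Separating.converges {L : Set ℕ} (hL : Separating L) (hT : IsTextFor T L) :
    ∃ a, lang a = L ∧ ∃ t₀, ∀ t ≥ t₀, memory update T t = some a := by
  have hT : content T = L := hT
  cases hL with
  | chain c hpoints =>
    exact ⟨_, rfl, eventually_chain (hT ▸ chainLang_subset_range c) (hT ▸ hpoints 0)⟩
  | stub c k _ hpoints =>
    exact ⟨_, rfl, eventually_stub (hT ▸ stubLang_subset_pool c k)
      (hT ▸ Set.mem_insert _ _) (hT ▸ hpoints)⟩
  | full c k _ hpoints =>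
    exact ⟨_, rfl, eventually_full (hT ▸ fullLang_subset_pool c k)
      (hT ▸ Set.mem_insert _ _) (hT ▸ hpoints)⟩
  | reacting c k _ heq =>
    rcases eventually_stub_or_full (hT ▸ fullLang_subset_pool c k)
      (hT ▸ Set.mem_insert _ _) with h | h
    exacts [⟨Hypothesis.stub c k, heq, h⟩, ⟨Hypothesis.full c k, rfl, h⟩]

theorem exists_computable_hypothesis_index {φ : ℕ → ℕ →. ℕ}
    (hφ : ∀ ψ : ℕ → ℕ →. ℕ, Partrec₂ ψ → ∃ f : ℕ → ℕ, Computable f ∧ ∀ p, φ (f p) = ψ p) :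
    ∃ f : Hypothesis → ℕ, Computable f ∧ ∀ a, W φ (f a) = lang a := by
  obtain ⟨f₁, hf₁, hchain⟩ := exists_computable_index hφ (L := chainLang) rePred_chainLang
  obtain ⟨f₂, hf₂, hstub⟩ := exists_computable_index hφ
    (L := fun x : Code × ℕ => stubLang x.1 x.2) rePred_stubLang
  obtain ⟨f₃, hf₃, hfull⟩ := exists_computable_index hφ
    (L := fun x : Code × ℕ => fullLang x.1 x.2) rePred_fullLang
  refine ⟨Sum.elim f₁ (Sum.elim f₂ f₃), ?_, ?_⟩
  · have hinr : Computable (Sum.elim f₂ f₃) :=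
      (Computable.sumCasesOn Computable.id (hf₂.comp Computable.snd).to₂
        (hf₃.comp Computable.snd).to₂).of_eq fun x => by cases x <;> rfl
    exact (Computable.sumCasesOn Computable.id (hf₁.comp Computable.snd).to₂
      (hinr.comp Computable.snd).to₂).of_eq fun x => by cases x <;> rfl
  · rintro (c | ⟨c, k⟩ | ⟨c, k⟩)
    exacts [hchain c, hstub (c, k), hfull (c, k)]

theorem setOf_separating_mem_txtBMSEx {φ : ℕ → ℕ →. ℕ}
    (hφ : ∀ ψ : ℕ → ℕ →. ℕ, Partrec₂ ψ → ∃ f : ℕ → ℕ, Computable f ∧ ∀ p, φ (f p) = ψ p) :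
    {L | Separating L} ∈ TxtBMSEx φ (SMon φ) := by
  obtain ⟨f, hf, hlang⟩ := exists_computable_hypothesis_index hφ
  refine mem_txtBMSEx_sMon_of_iterative primrec_update.to_comp hf hlang
    (fun L hL => Separating.rePred hL) (fun L hL T hT s t hst a b ha hb => ?_)
    fun L hL T hT => Separating.converges hL hT
  have hle : memoryLang (memory update T s) ⊆ memoryLang (memory update T t) :=
    Separating.monotone hL hT hst
  rwa [ha, hb] at hle

end Learner

section Simulation

/-- The sequence of the last hypotheses proper of the learning sequence `h`. -/
def lastHyp (h : ℕ → Conjecture) : ℕ → Conjecture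
  | 0 => h 0
  | t + 1 => h (t + 1) <|> lastHyp h t

/-- The transition function of the machine that simulates the learner `M` and remembers its last
hypothesis. -/
def rememberingStep (M : BMSLearner) : (ℕ × Conjecture) × Datum →. ℕ × Conjecture := fun y =>
  (M.trans y.1.1 y.2).bind fun q => (M.hyp y.1.1 y.2).map fun e => (q, e <|> y.1.2)

theorem partrec_rememberingStep (M : BMSLearner) : Partrec (rememberingStep M) := by
  have hq : Computable fun y : (ℕ × Conjecture) × Datum => y.1.1 :=
    Computable.fst.comp Computable.fst
  refine (M.trans_partrec.comp hq Computable.snd).bind ?_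
  refine ((M.hyp_partrec.comp hq Computable.snd).comp Computable.fst).map ?_
  exact (Computable.snd.comp Computable.fst).pair (Primrec.option_orElse.to_comp.comp
    Computable.snd (Computable.snd.comp
      (Computable.fst.comp (Computable.fst.comp Computable.fst))))

theorem exists_code_eval_encode {α β : Type*} [Primcodable α] [Primcodable β] {f : α →. β}
    (hf : Partrec f) : ∃ c : Code, ∀ a, c.eval (encode a) = (f a).map encode := by
  obtain ⟨c, hc⟩ := Code.exists_code.1 hf
  exact ⟨c, fun a => by simp [hc]⟩

theorem exists_code_simulating (M : BMSLearner) : ∃ c : Code, ∀ T h, M.IsLearningSeq T h →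
    ∀ t, ∃ q ∈ M.state (initSeg T t),
      run c (initSeg T t) = Part.some (encode (q, lastHyp h t)) := by
  obtain ⟨c, hc⟩ := exists_code_eval_encode (partrec_rememberingStep M)
  refine ⟨c, fun T h hT t => ?_⟩
  induction t with
  | zero =>
    have h0 : h 0 = none := Part.mem_some_iff.1 (hT 0)
    exact ⟨0, Part.mem_some 0, by rw [lastHyp, h0]; rfl⟩
  | succ t ih =>
    obtain ⟨q, hq, hrun⟩ := ih
    have hstate := Part.eq_some_iff.2 hq
    have hhyp := hT (t + 1)
    rw [initSeg_succ, BMSLearner.output_append, hstate, Part.bind_some] at hhyp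
    obtain ⟨q', hq'⟩ := Part.dom_iff_mem.1 ((M.dom_eq q (T t)).1 (Part.dom_iff_mem.2 ⟨_, hhyp⟩))
    rw [initSeg_succ, BMSLearner.state_append, hstate, Part.bind_some]
    refine ⟨q', hq', ?_⟩
    rw [run_concat, hrun, Part.bind_some]
    refine (hc ((q, lastHyp h t), T t)).trans ?_
    rw [rememberingStep, Part.eq_some_iff.2 hq', Part.eq_some_iff.2 hhyp]
    simp [lastHyp]

theorem exists_eq_some_of_lastHyp_eq_some {h : ℕ → Conjecture} {t e : ℕ}
    (ht : lastHyp h t = some e) : ∃ s ≤ t, h s = some e := by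
  induction t with
  | zero => exact ⟨0, le_rfl, ht⟩
  | succ t ih =>
    cases hs : h (t + 1) with
    | none =>
      rw [lastHyp, hs] at ht
      obtain ⟨s, hst, hse⟩ := ih ht
      exact ⟨s, by omega, hse⟩
    | some d =>
      rw [lastHyp, hs] at ht
      exact ⟨t + 1, le_rfl, hs.trans ht⟩

theorem lastHyp_eq_some_of_forall {h : ℕ → Conjecture} {s e : ℕ} (hs : lastHyp h s = some e)
    (hh : ∀ t > s, h t ≠ none → h t = some e) : ∀ t ≥ s, lastHyp h t = some e := by
  refine Nat.le_induction hs fun t ht ih => ?_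
  by_cases hnone : h (t + 1) = none
  · rw [lastHyp, hnone, ih]; rfl
  · rw [lastHyp, hh (t + 1) (by omega) hnone]; rfl

theorem lastHyp_eq_some {h : ℕ → Conjecture} {t e : ℕ} (ht : h t = some e) :
    lastHyp h t = some e := by
  cases t <;> rw [lastHyp, ht]; rfl

variable {φ : ℕ → ℕ →. ℕ} {h : ℕ → Conjecture} {L : Set ℕ}

theorem exists_forall_ge_lastHyp_eq_some (hEx : Ex φ h L) :
    ∃ e t₀, W φ e = L ∧ ∀ t ≥ t₀, lastHyp h t = some e := by
  obtain ⟨t₀, e, he, hW, hconv⟩ := hEx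
  exact ⟨e, t₀, hW, lastHyp_eq_some_of_forall (lastHyp_eq_some he)
    fun t ht hne => (hconv t ht.le hne).trans he⟩

theorem lastHyp_stable (hSNU : SNU φ h L) (hEx : Ex φ h L) {r e : ℕ}
    (hr : lastHyp h r = some e) (hW : W φ e = L) : ∀ t ≥ r, lastHyp h t = some e := by
  obtain ⟨s, hsr, hs⟩ := exists_eq_some_of_lastHyp_eq_some hr
  obtain ⟨t₀, e', he', hW', hconv⟩ := hEx
  refine lastHyp_eq_some_of_forall hr fun t ht hne => ?_
  obtain ⟨d, hd⟩ := Option.ne_none_iff_exists'.1 hne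
  have hlate : h (max t t₀) = some e' := by
    rcases le_total t t₀ with hle | hle
    · rwa [max_eq_right hle]
    · rw [max_eq_left hle, hconv t hle hne, he']
  rw [hd, hSNU s t (max t t₀) (by omega) (le_max_left _ _) e d e' hs hd hlate hW hW']

/-- On the text `T` for `L`, the machine `c` is total, has finitely many configurations, its
hypothesis converges to an index of `L`, and it is never withdrawn once it is correct. -/
structure Succeeds (φ : ℕ → ℕ →. ℕ) (c : Code) (L : Set ℕ) (T : ℕ → Datum) : Prop where
  dom : ∀ t, (run c (initSeg T t)).Dom
  finite : (Set.range fun t => run c (initSeg T t)).Finite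
  converges : ∃ e t₀, W φ e = L ∧ ∀ t ≥ t₀, hypAfter c (initSeg T t) = Part.some (some e)
  stable : ∀ r e, hypAfter c (initSeg T r) = Part.some (some e) → W φ e = L →
    ∀ t ≥ r, hypAfter c (initSeg T t) = Part.some (some e)

theorem exists_succeeds {𝓛 : Set (Set ℕ)} (h𝓛 : 𝓛 ∈ TxtBMSEx φ (SNU φ)) :
    ∃ c, ∀ L ∈ 𝓛, ∀ T, IsTextFor T L → Succeeds φ c L T := by
  obtain ⟨-, M, hM⟩ := h𝓛
  obtain ⟨c, hc⟩ := exists_code_simulating M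
  refine ⟨c, fun L hL T hT => ?_⟩
  obtain ⟨h, hseq, hfin, hSNU, hEx⟩ := hM L hL T hT
  choose q hq hrun using hc T h hseq
  have hhyp : ∀ t, hypAfter c (initSeg T t) = Part.some (lastHyp h t) := fun t => by
    simp [hypAfter, hrun t, currentHyp]
  obtain ⟨e, t₀, hW, hlast⟩ := exists_forall_ge_lastHyp_eq_some hEx
  refine ⟨fun t => by simp [hrun t], ?_, ⟨e, t₀, hW, fun t ht => by rw [hhyp, hlast t ht]⟩,
    fun r e hr hW t ht => ?_⟩
  · refine ((hfin.prod (finite_range_of_eventually_eq hlast)).image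
      fun y => Part.some (encode y)).subset ?_
    rintro _ ⟨t, rfl⟩
    exact ⟨(q t, lastHyp h t), ⟨⟨t, hq t⟩, t, rfl⟩, (hrun t).symm⟩
  · rw [hhyp, Part.some_inj] at hr
    rw [hhyp, lastHyp_stable hSNU hEx hr hW t ht]

end Simulation

section Adversary

/-- The text that continues the finite sequence `σ` by the text `T`. -/
def prepend (σ : List Datum) (T : ℕ → Datum) : ℕ → Datum := fun t => σ.getD t (T (t - σ.length))

theorem prepend_length_add (σ : List Datum) (T : ℕ → Datum) (t : ℕ) :
    prepend σ T (σ.length + t) = T t := by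
  simp [prepend]

theorem initSeg_prepend (σ : List Datum) (T : ℕ → Datum) (t : ℕ) :
    initSeg (prepend σ T) (σ.length + t) = σ ++ initSeg T t := by
  induction t with
  | zero =>
    refine List.ext_getElem (by simp [initSeg]) fun i hi _ => ?_
    have hi : i < σ.length := by simpa [initSeg] using hi
    simp [initSeg, prepend, hi]
  | succ t ih =>
    rw [← add_assoc, initSeg_succ, ih, prepend_length_add, initSeg_succ, List.append_assoc]

theorem content_prepend (σ : List Datum) (T : ℕ → Datum) :
    content (prepend σ T) = {n | some n ∈ σ} ∪ content T := by
  ext n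
  constructor
  · rintro ⟨t, ht⟩
    rcases lt_or_ge t σ.length with hlt | hge
    · rw [prepend, List.getD_eq_getElem _ _ hlt] at ht
      exact .inl (List.mem_of_getElem ht)
    · obtain ⟨s, rfl⟩ := Nat.exists_eq_add_of_le hge
      exact .inr ⟨s, by rwa [prepend_length_add] at ht⟩
  · rintro (hn | ⟨t, ht⟩)
    · obtain ⟨t, hlt, ht⟩ := List.getElem_of_mem hn
      exact ⟨t, by rw [prepend, List.getD_eq_getElem _ _ hlt, ht]⟩
    · exact ⟨σ.length + t, by rw [prepend_length_add, ht]⟩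

/-- The text that presents all points of the chain built against `c` in order. -/
def chainText (c : Code) : ℕ → Datum := fun i => some (point c i)

/-- The text for the empty language. -/
def pauses : ℕ → Datum := fun _ => none

variable {φ : ℕ → ℕ →. ℕ} {c : Code} {L : Set ℕ} {σ : List Datum} {T : ℕ → Datum}
  {e k m n r s : ℕ}

theorem content_chainText (c : Code) : content (chainText c) = Set.range (point c) := by
  ext n
  simp [content, chainText]

theorem content_pauses : content pauses = ∅ := by
  simp [content, pauses]

theorem some_mem_points : some n ∈ points c m ↔ n ∈ point c '' Set.Iio m := by
  simp [points]

theorem content_prepend_probe (c : Code) (m k r : ℕ) (T : ℕ → Datum) :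
    content (prepend (probe c m k r) T) =
      insert (marker c k) (point c '' Set.Iio m ∪ content T) := by
  rw [content_prepend]
  ext n
  simp [probe, some_mem_points, or_assoc, or_left_comm, eq_comm]

theorem probe_append_initSeg_pauses (c : Code) (m k r s : ℕ) :
    probe c m k r ++ initSeg pauses s = probe c m k (r + s) := by
  have hpauses : initSeg pauses s = List.replicate s none := List.map_const' .. |>.trans (by simp)
  simp [probe, hpauses, List.map_const']

theorem frequently_eq_of_finite_range {α : Type*} {f : ℕ → α} (hf : (Set.range f).Finite) :
    ∃ y, ∃ᶠ n in atTop, f n = y := by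
  by_contra! h
  obtain ⟨n, hn⟩ := ((Filter.eventually_all_finite hf).2 fun y _ => h y).exists
  exact hn (f n) ⟨n, rfl⟩ rfl

theorem point_injective (c : Code) : Function.Injective (point c) := fun i j h => by
  simpa [point] using h

theorem point_mem_insert_marker_iff {i : ℕ} {S : Set ℕ} :
    point c i ∈ insert (marker c k) (point c '' S) ↔ i ∈ S := by
  rw [Set.mem_insert_iff, (point_injective c).mem_set_image, or_iff_right]
  exact fun h => marker_notMem_range_point c c k ⟨i, h⟩

theorem run_probe_add_mul (h : run c (probe c m k (r + s + 1)) = run c (probe c m k r)) (a : ℕ) :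
    run c (probe c m k (r + a * (s + 1))) = run c (probe c m k r) := by
  induction a with
  | zero => simp
  | succ a ih =>
    rw [show r + (a + 1) * (s + 1) = r + a * (s + 1) + (s + 1) by ring,
      ← probe_append_initSeg_pauses, run_append_congr ih, probe_append_initSeg_pauses, ← h]
    rfl

theorem Succeeds.exists_hypAfter (h : Succeeds φ c L (prepend σ T)) :
    ∃ e t₀, W φ e = L ∧ ∀ t ≥ t₀, hypAfter c (σ ++ initSeg T t) = Part.some (some e) := by
  obtain ⟨e, t₀, hW, hconv⟩ := h.converges
  refine ⟨e, t₀, hW, fun t ht => ?_⟩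
  rw [← initSeg_prepend]
  exact hconv _ (by omega)

theorem Succeeds.run_append_dom (h : Succeeds φ c L (prepend σ T)) (t : ℕ) :
    (run c (σ ++ initSeg T t)).Dom := by
  rw [← initSeg_prepend]
  exact h.dom _

theorem Succeeds.hypAfter_append (h : Succeeds φ c L (prepend σ T)) (hW : W φ e = L)
    (hσ : hypAfter c σ = Part.some (some e)) (t : ℕ) :
    hypAfter c (σ ++ initSeg T t) = Part.some (some e) := by
  rw [← initSeg_prepend]
  refine h.stable σ.length e ?_ hW _ (by omega)
  have hinit := initSeg_prepend σ T 0
  rw [Nat.add_zero] at hinit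
  rw [hinit]
  simpa [initSeg] using hσ

theorem Succeeds.exists_loop (h : Succeeds φ c L (prepend (probe c m k 0) pauses)) :
    ∃ e r s, W φ e = L ∧ hypAfter c (probe c m k r) = Part.some (some e) ∧
      run c (probe c m k (r + s + 1)) = run c (probe c m k r) := by
  obtain ⟨e, t₀, hW, hconv⟩ := h.exists_hypAfter
  have hprobe : ∀ r, initSeg (prepend (probe c m k 0) pauses) ((probe c m k 0).length + r) =
      probe c m k r := fun r => by
    rw [initSeg_prepend, probe_append_initSeg_pauses, zero_add]
  obtain ⟨y, hy⟩ := frequently_eq_of_finite_range (f := fun r => run c (probe c m k r))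
    (h.finite.subset (Set.range_subset_iff.2 fun r => ⟨_, congrArg (run c) (hprobe r)⟩))
  obtain ⟨r, hr, hry⟩ := frequently_atTop.1 hy t₀
  obtain ⟨_, hs, hsy⟩ := frequently_atTop.1 hy (r + 1)
  obtain ⟨s, rfl⟩ := Nat.exists_eq_add_of_le hs
  refine ⟨e, r, s, hW, ?_, ?_⟩
  · rw [← hconv r hr, probe_append_initSeg_pauses, zero_add]
  · rw [add_right_comm]
    exact hsy.trans hry.symm

theorem chainLang_subset_stubLang (hnew : ∀ n, IsNew c n → n ≤ k) :
    chainLang c ⊆ stubLang c k := by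
  rintro _ ⟨i, ⟨n, hin, hn⟩, rfl⟩
  exact .inr ⟨i, .inl (hin.trans_le (hnew n hn)), rfl⟩

theorem stubLang_eq_of_not (h : ∀ i ≥ k, ¬ (Uncut c k i ∧ Reacts c k)) :
    stubLang c k = insert (marker c k) (point c '' Set.Iio k) := by
  have hindex : {i | i < k ∨ Uncut c k i ∧ Reacts c k} = Set.Iio k :=
    Set.ext fun i => or_iff_left_of_imp fun hi => not_le.1 fun hki => h i hki hi
  rw [stubLang, hindex]

theorem stubLang_eq_fullLang (h : Reacts c k) : stubLang c k = fullLang c k := by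
  simp only [stubLang, fullLang, h, and_true]

theorem fullLang_eq_of_isCut (hdom : ∀ n, (run c (points c n)).Dom) (hcut : IsCut c k m)
    (hleast : ∀ l < m, ¬ IsCut c k l) :
    fullLang c k = insert (marker c k) (point c '' Set.Iio m) := by
  have hindex : {i | i < k ∨ Uncut c k i} = Set.Iio m := Set.ext fun i =>
    ⟨fun hi => hi.elim (fun hik => hik.trans_le hcut.1)
      fun hu => not_le.1 fun hmi => hu.2 m hmi hcut,
    fun hi => .inr ⟨hdom i, fun l hl => hleast l (hl.trans_lt hi)⟩⟩
  rw [fullLang, hindex]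

theorem fullLang_eq_of_not_reacts (hdom : ∀ n, (run c (points c n)).Dom) (h : ¬ Reacts c k) :
    fullLang c k = insert (marker c k) (Set.range (point c)) := by
  have hindex : {i | i < k ∨ Uncut c k i} = Set.univ := Set.eq_univ_of_forall fun i => by
    refine .inr ⟨hdom i, ?_⟩
    rintro m - ⟨-, -, u, -, hu⟩
    exact h (reacts_iff.2 ⟨u, hu⟩)
  rw [fullLang, hindex, Set.image_univ]

theorem exists_least_isCut (h : Reacts c k)
    (hrec : ∃ᶠ m in atTop, run c (points c m) = run c (points c k)) :
    ∃ m, IsCut c k m ∧ ∀ l < m, ¬ IsCut c k l := by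
  have hcut : ∃ m, IsCut c k m := by
    obtain ⟨u, hu⟩ := reacts_iff.1 h
    obtain ⟨m, hm, hrun⟩ := frequently_atTop.1 hrec (max k (u + 1))
    exact ⟨m, by omega, hrun, u, by omega, hu⟩
  classical
  exact ⟨Nat.find hcut, Nat.find_spec hcut, fun l => Nat.find_min hcut⟩

theorem separating_stubLang (hchain : chainLang c ⊆ stubLang c k)
    (hstub : stubLang c k = insert (marker c k) (point c '' Set.Iio k)) :
    Separating (stubLang c k) :=
  .stub c k hchain fun i hi h => by
    rw [hstub, point_mem_insert_marker_iff] at h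
    exact not_lt_of_ge hi h

variable (hc : ∀ L, Separating L → ∀ T, IsTextFor T L → Succeeds φ c L T)
include hc

theorem finite_setOf_isNew : {n | IsNew c n}.Finite := by
  by_contra hinf
  have hpoints : ∀ i, point c i ∈ chainLang c := fun i => by
    obtain ⟨n, hn, hin⟩ := Set.Infinite.exists_gt hinf i
    exact ⟨i, ⟨n, hin, hn⟩, rfl⟩
  have htext : IsTextFor (chainText c) (chainLang c) := (content_chainText c).trans
    (Set.Subset.antisymm (Set.range_subset_iff.2 hpoints) (chainLang_subset_range c))
  refine Set.infinite_of_injOn_mapsTo (f := fun n => run c (points c n)) ?_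
    (fun n _ => Set.mem_range_self n) hinf (hc _ (.chain c hpoints) _ htext).finite
  intro m hm n hn hmn
  rcases lt_trichotomy m n with h | h | h
  exacts [absurd hmn (hn.2 m h), h, absurd hmn.symm (hm.2 n h)]

theorem run_points_dom (n : ℕ) : (run c (points c n)).Dom := by
  by_contra hn
  obtain ⟨b, hb⟩ := (finite_setOf_isNew hc).bddAbove
  have hstub : stubLang c (max n b) = _ := stubLang_eq_of_not fun i hi h =>
    hn (run_points_dom_of_le (by omega) h.1.1)
  have hsucceeds := hc _ (separating_stubLang (chainLang_subset_stubLang fun m hm =>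
    (hb hm).trans (le_max_right n b)) hstub) (prepend (probe c (max n b) (max n b) 0) pauses) (by
      rw [IsTextFor, content_prepend_probe, content_pauses, Set.union_empty, hstub])
  exact hn (run_points_dom_of_le (le_max_left n b)
    (run_dom_of_append (run_dom_of_append (hsucceeds.run_append_dom 0))))

theorem finite_range_run_points : (Set.range fun n => run c (points c n)).Finite := by
  refine ((finite_setOf_isNew hc).image fun n => run c (points c n)).subset ?_
  rintro _ ⟨n, rfl⟩
  classical
  have hex : ∃ j, run c (points c j) = run c (points c n) := ⟨n, rfl⟩
  refine ⟨Nat.find hex, ⟨run_points_dom hc _, fun j hj h => ?_⟩, Nat.find_spec hex⟩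
  exact Nat.find_min hex hj (h.trans (Nat.find_spec hex))

theorem not_reacts_of_frequently (hchain : chainLang c ⊆ stubLang c k)
    (hrec : ∃ᶠ m in atTop, run c (points c m) = run c (points c k)) : ¬ Reacts c k := by
  intro hreacts
  obtain ⟨m, hm, hleast⟩ := exists_least_isCut hreacts hrec
  have hsep : Separating (insert (marker c k) (point c '' Set.Iio m)) :=
    fullLang_eq_of_isCut (run_points_dom hc) hm hleast ▸
      .reacting c k hchain (stubLang_eq_fullLang hreacts)
  obtain ⟨-, hrun, u, hum, r, -, s, -, j, hju, hreaction⟩ := hm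
  obtain ⟨-, hloop, hne⟩ := hreaction.reaction
  have hprobe : ∀ r, run c (probe c m k r) = run c (probe c k k r) := fun r =>
    run_append_congr hrun _
  obtain ⟨e, t₀, hW, hconv⟩ := (hc _ hsep (prepend (probe c m k r) pauses) (by
    rw [IsTextFor, content_prepend_probe, content_pauses, Set.union_empty])).exists_hypAfter
  have hcorrect : hypAfter c (probe c m k r) = Part.some (some e) := by
    have hlate := hconv (t₀ * (s + 1)) (Nat.le_mul_of_pos_right t₀ s.succ_pos)
    rwa [probe_append_initSeg_pauses, hypAfter_congr
      (run_probe_add_mul (by rw [hprobe, hprobe, hloop]) t₀)] at hlate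
  have hsucceeds := hc _ hsep (prepend (probe c m k r) (prepend (points c j) pauses)) (by
    have hsub : point c '' Set.Iio j ⊆ point c '' Set.Iio m :=
      Set.image_mono (Set.Iio_subset_Iio (hju.trans hum).le)
    rw [IsTextFor, content_prepend_probe, content_prepend, content_pauses, Set.union_empty]
    simp only [some_mem_points, Set.ofPred_mem_eq, Set.union_eq_left.2 hsub])
  have hstable := hsucceeds.hypAfter_append hW hcorrect ((points c j).length + 0)
  rw [initSeg_prepend] at hstable
  refine hne ?_
  rw [← hypAfter_congr (hprobe r), hcorrect, ← hypAfter_congr (run_append_congr (hprobe r) _)]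
  simpa [initSeg] using hstable

theorem reacts_of_chainLang_subset (hchain : chainLang c ⊆ stubLang c k) : Reacts c k := by
  by_contra hreacts
  have hstub : stubLang c k = _ := stubLang_eq_of_not fun _ _ h => hreacts h.2
  have hfull := fullLang_eq_of_not_reacts (run_points_dom hc) hreacts
  have hpoints : ∀ i, point c i ∈ fullLang c k := fun i => hfull ▸ .inr ⟨i, rfl⟩
  obtain ⟨e, r, s, hW, hcorrect, hloop⟩ := (hc _ (separating_stubLang hchain hstub)
    (prepend (probe c k k 0) pauses) (by
      rw [IsTextFor, content_prepend_probe, content_pauses, Set.union_empty, hstub])).exists_loop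
  have hsucceeds := hc _ (.full c k hchain hpoints) (prepend (probe c k k r) (chainText c)) (by
    rw [IsTextFor, content_prepend_probe, content_chainText, hfull,
      Set.union_eq_right.2 (Set.image_subset_range _ _)])
  have hkeep : ∀ j, hypAfter c (probe c k k r ++ points c j) = Part.some (some e) := fun j => by
    by_contra hne
    exact hreacts ⟨r, s, j, hsucceeds.run_append_dom j, hloop, hcorrect ▸ hne⟩
  obtain ⟨e', t₀, hW', hconv⟩ := hsucceeds.exists_hypAfter
  obtain rfl : e = e' :=
    Option.some.inj (Part.some_inj.1 ((hkeep t₀).symm.trans (hconv t₀ le_rfl)))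
  have hmem : point c k ∈ stubLang c k := hW.symm.trans hW' ▸ hpoints k
  rw [hstub, point_mem_insert_marker_iff] at hmem
  exact lt_irrefl k hmem

end Adversary

theorem setOf_separating_notMem_txtBMSEx (φ : ℕ → ℕ →. ℕ) :
    {L | Separating L} ∉ TxtBMSEx φ (SNU φ) := by
  intro h
  obtain ⟨c, hc⟩ := exists_succeeds h
  obtain ⟨b, hb⟩ := (finite_setOf_isNew hc).bddAbove
  obtain ⟨y, hy⟩ := frequently_eq_of_finite_range (finite_range_run_points hc)
  obtain ⟨k, hbk, rfl⟩ := frequently_atTop.1 hy b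
  have hchain : chainLang c ⊆ stubLang c k :=
    chainLang_subset_stubLang fun n hn => (hb hn).trans hbk
  exact not_reacts_of_frequently hc hchain hy (reacts_of_chainLang_subset hc hchain)

theorem txtBMSEx_mono {φ : ℕ → ℕ →. ℕ} {δ δ' : Restriction} (h : ∀ u L, δ u L → δ' u L) :
    TxtBMSEx φ δ ⊆ TxtBMSEx φ δ' := fun _ ⟨hre, M, hM⟩ =>
  ⟨hre, M, fun L hL T hT => by
    obtain ⟨u, hseq, hfin, hδ, hEx⟩ := hM L hL T hT
    exact ⟨u, hseq, hfin, h u L hδ, hEx⟩⟩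

end LimitLearning

open LimitLearning in
theorem mainTheorem4_general (φ : ℕ → ℕ →. ℕ)
    (hφ : ∀ ψ : ℕ → ℕ →. ℕ, Partrec₂ ψ → ∃ f : ℕ → ℕ, Computable f ∧ ∀ p, φ (f p) = ψ p) :
    ¬ (TxtBMSEx φ (SMon φ) ⊆ TxtBMSEx φ (SNU φ)) ∧
      TxtBMSEx φ (SNU φ) ⊂ TxtBMSEx φ NoRestriction := by
  have hSMon := setOf_separating_mem_txtBMSEx hφ
  have hSNU := setOf_separating_notMem_txtBMSEx φ
  have hEx := txtBMSEx_mono (fun _ _ _ => trivial : ∀ u L, SMon φ u L → NoRestriction u L) hSMon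
  exact ⟨fun h => hSNU (h hSMon), txtBMSEx_mono fun _ _ _ => trivial, fun h => hSNU (h hEx)⟩

theorem mainTheorem4 (φ : ℕ → ℕ →. ℕ) (hφ : LimitLearning.IsAcceptable φ) :
    ¬ (LimitLearning.TxtBMSEx φ (LimitLearning.SMon φ) ⊆
        LimitLearning.TxtBMSEx φ (LimitLearning.SNU φ)) ∧
    LimitLearning.TxtBMSEx φ (LimitLearning.SNU φ) ⊂
        LimitLearning.TxtBMSEx φ LimitLearning.NoRestriction :=
  mainTheorem4_general φ hφ.2
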